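/- Let $M$ be a smooth manifold and let $A\to M$ be a smooth real vector bundle of finite rank with a Lie algebroid structure $([\cdot,\cdot],\rho)$, with differential $d$. Let $\phi_0\in\Omega^1(A)=\Gamma(A^*)$ be a 1-cocycle, $d\phi_0=0$, so that $(A,\phi_0)$ is a Jacobi algebroid. Put $d^{\phi_0}\omega=d\omega+\phi_0\wedge\omega$ and, for $X\in\Gamma(A)$, $\mathcal L^{\phi_0}_X\omega=i_Xd^{\phi_0}\omega+d^{\phi_0}i_X\omega$ for 1-forms $\omega$. For a bivector $P\in\Gamma(\Lambda^2A)$ let $P^\sharp:A^*\to A$ be given by $\langle\beta,P^\sharp\alpha\rangle=P(\alpha,\beta)$, and for $\alpha,\beta\in\Omega^1(A)$ put $$[\alpha,\beta]_P=\mathcal L^{\phi_0}_{P^\sharp\alpha}\beta-\mathcal L^{\phi_0}_{P^\sharp\beta}\alpha-d^{\phi_0}\big(P(\alpha,\beta)\big).$$ $P$ is a Jacobi bivector if $[P,P]^{\phi_0}:=[P,P]+2\,P^\sharp\phi_0\wedge P=0$, where $[P,P]$ is the Schouten bracket, with the sign convention $[X\wedge Y,Z\wedge W]=[X,Z]\wedge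 Y\wedge W-[X,W]\wedge Y\wedge Z-[Y,Z]\wedge X\wedge W+[Y,W]\wedge X\wedge Z$. A Nijenhuis operator on a Lie algebroid is a vector bundle endomorphism $N$ over the identity such that $[NX,NY]=N[X,Y]_N$ for all sections $X,Y$, where $[X,Y]_N=[NX,Y]+[X,NY]-N[X,Y]$; then $A_N=(A,[\cdot,\cdot]_N,\rho\circ N)$ is again a Lie algebroid. Let $(A,\phi_0,P,N)$ be a Jacobi–Nijenhuis algebroid, that is, $(A,\phi_0)$ is a Jacobi algebroid, $P$ is a Jacobi bivector, $N$ is a Nijenhuis operator on $A$, $N\circ P^\sharp=P^\sharp\circ N^*$ (so that $NP$, with $(NP)^\sharp=N\circ P^\sharp$, is a bivector), and $[\alpha,\beta]_{NP}=[\alpha,\beta]^N_P$ for all $\alpha,\beta\in\Omega^1(A)$, where $[\cdot,\cdot]_{NP}$ is the bracket above with $NP$ in place of $P$, and $[\cdot,\cdot]_P^N$ is the bracket defined by $P$ with $(A_N,N^*\phi_0)$ in place of $(A,\phi_0)$. Then the bracket $[\cdot,\cdot]_P$ and the anchor $\rho\circ P^\sharp$ define a Lie algebroid structure on $A^*$,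 and the transpose $N^*:A^*\to A^*$ is a Nijenhuis operator for this Lie algebroid. -/

import Mathlib

open Bundle ContDiff Manifold

noncomputable section JacobiAlgebroids

variable {E : Type*} [NormedAddCommGroup E] [NormedSpace ℝ E]
  {H : Type*} [TopologicalSpace H] (I : ModelWithCorners ℝ E H)
  {M : Type*} [TopologicalSpace M] [ChartedSpace H M]

section BundleMaps

variable (F₁ : Type*) [NormedAddCommGroup F₁] [NormedSpace ℝ F₁]
  (V₁ : M → Type*) [TopologicalSpace (TotalSpace F₁ V₁)]
  [∀ x, AddCommGroup (V₁ x)] [∀ x, Module ℝ (V₁ x)] [∀ x, TopologicalSpace (V₁ x)]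
  [FiberBundle F₁ V₁] [VectorBundle ℝ F₁ V₁]
  (F₂ : Type*) [NormedAddCommGroup F₂] [NormedSpace ℝ F₂]
  (V₂ : M → Type*) [TopologicalSpace (TotalSpace F₂ V₂)]
  [∀ x, AddCommGroup (V₂ x)] [∀ x, Module ℝ (V₂ x)] [∀ x, TopologicalSpace (V₂ x)]
  [∀ x, IsTopologicalAddGroup (V₂ x)] [∀ x, ContinuousSMul ℝ (V₂ x)]
  [FiberBundle F₂ V₂] [VectorBundle ℝ F₂ V₂]

/-- Smooth vector bundle maps over the identity of `M`, that is, smooth sections of the bundle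
`Hom(V₁, V₂)`. -/
abbrev BundleMap : Type _ := Cₛ^∞⟮I; F₁ →L[ℝ] F₂, fun x ↦ V₁ x →L[ℝ] V₂ x⟯

/-- The dual vector bundle. Its smooth sections are the 1-forms on `V₁`. -/
abbrev DualBundle : M → Type _ := fun x ↦ V₁ x →L[ℝ] Bundle.Trivial M ℝ x

/-- The space `Ω¹(V₁)` of 1-forms on `V₁`, the smooth sections of the dual bundle. -/
abbrev OneForm : Type _ := Cₛ^∞⟮I; F₁ →L[ℝ] ℝ, DualBundle V₁⟯

variable {I F₁ V₁ F₂ V₂}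
variable {F₃ : Type*} [NormedAddCommGroup F₃] [NormedSpace ℝ F₃]
  {V₃ : M → Type*} [TopologicalSpace (TotalSpace F₃ V₃)]
  [∀ x, AddCommGroup (V₃ x)] [∀ x, Module ℝ (V₃ x)] [∀ x, TopologicalSpace (V₃ x)]
  [∀ x, IsTopologicalAddGroup (V₃ x)] [∀ x, ContinuousSMul ℝ (V₃ x)]
  [FiberBundle F₃ V₃] [VectorBundle ℝ F₃ V₃]

/-- The action of a bundle map on sections. -/
def BundleMap.onSections (Φ : BundleMap I F₁ V₁ F₂ V₂) (X : Cₛ^∞⟮I; F₁, V₁⟯) : Cₛ^∞⟮I; F₂, V₂⟯ :=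
  ⟨fun x ↦ Φ x (X x), Φ.contMDiff.clm_bundle_apply X.contMDiff⟩

theorem BundleMap.comp_contMDiff (Ψ : BundleMap I F₂ V₂ F₃ V₃) (Φ : BundleMap I F₁ V₁ F₂ V₂) :
    ContMDiff I (I.prod 𝓘(ℝ, F₁ →L[ℝ] F₃)) ∞
      (fun x ↦ TotalSpace.mk' (F₁ →L[ℝ] F₃) (E := fun x ↦ V₁ x →L[ℝ] V₃ x) x
        ((Ψ x).comp (Φ x))) := by
  intro x₀
  have hΨ := (contMDiffAt_hom_bundle _).1 (Ψ.contMDiff x₀)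
  have hΦ := (contMDiffAt_hom_bundle _).1 (Φ.contMDiff x₀)
  refine (contMDiffAt_hom_bundle _).2 ⟨contMDiffAt_id, ?_⟩
  refine (hΨ.2.clm_comp hΦ.2).congr_of_eventuallyEq ?_
  filter_upwards [(trivializationAt F₂ V₂ x₀).open_baseSet.mem_nhds
    (FiberBundle.mem_baseSet_trivializationAt' x₀)] with x hx
  ext v
  simp [ContinuousLinearMap.inCoordinates, hx]

/-- Composition of bundle maps. -/
def BundleMap.comp (Ψ : BundleMap I F₂ V₂ F₃ V₃) (Φ : BundleMap I F₁ V₁ F₂ V₂) :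
    BundleMap I F₁ V₁ F₃ V₃ :=
  ⟨fun x ↦ (Ψ x).comp (Φ x), Ψ.comp_contMDiff Φ⟩

theorem BundleMap.transpose_contMDiff (Φ : BundleMap I F₁ V₁ F₂ V₂) :
    ContMDiff I (I.prod 𝓘(ℝ, (F₂ →L[ℝ] ℝ) →L[ℝ] (F₁ →L[ℝ] ℝ))) ∞
      (fun x ↦ TotalSpace.mk' ((F₂ →L[ℝ] ℝ) →L[ℝ] (F₁ →L[ℝ] ℝ))
        (E := fun x ↦ DualBundle V₂ x →L[ℝ] DualBundle V₁ x) x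
        ((Φ x).precomp (Bundle.Trivial M ℝ x))) := by
  intro x₀
  have hΦ := (contMDiffAt_hom_bundle _).1 (Φ.contMDiff x₀)
  refine (contMDiffAt_hom_bundle _).2 ⟨contMDiffAt_id, ?_⟩
  let T : (F₁ →L[ℝ] F₂) →L[ℝ] ((F₂ →L[ℝ] ℝ) →L[ℝ] (F₁ →L[ℝ] ℝ)) :=
    (ContinuousLinearMap.compL ℝ F₁ F₂ ℝ).flip
  have hT : ContDiff ℝ ∞ (fun A ↦ T A) := by fun_prop
  have key := hT.contMDiff.contMDiffAt.comp x₀ hΦ.2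
  refine key.congr_of_eventuallyEq ?_
  filter_upwards [(trivializationAt F₂ V₂ x₀).open_baseSet.mem_nhds
    (FiberBundle.mem_baseSet_trivializationAt' x₀),
    (trivializationAt F₁ V₁ x₀).open_baseSet.mem_nhds
    (FiberBundle.mem_baseSet_trivializationAt' x₀)] with x hx hx'
  have hb₁ : x ∈ (trivializationAt (F₁ →L[ℝ] ℝ) (DualBundle V₁) x₀).baseSet := by simpa using hx'
  have hb₂ : x ∈ (trivializationAt (F₂ →L[ℝ] ℝ) (DualBundle V₂) x₀).baseSet := by simpa using hx
  ext α v
  set β : DualBundle V₂ x :=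
    (trivializationAt (F₂ →L[ℝ] ℝ) (DualBundle V₂) x₀).symmL ℝ x α with hβ
  have hα : α = (trivializationAt (F₂ →L[ℝ] ℝ) (DualBundle V₂) x₀).continuousLinearMapAt ℝ x β := by
    rw [hβ, Trivialization.continuousLinearMapAt_symmL _ hb₂]
  have h₁ : ∀ w, α w = β ((trivializationAt F₂ V₂ x₀).symmL ℝ x w) := by
    intro w
    rw [hα, Trivialization.continuousLinearMapAt_apply, Trivialization.coe_linearMapAt_of_mem _ hb₂]
    change ContinuousLinearMap.inCoordinates F₂ V₂ ℝ (Bundle.Trivial M ℝ) x₀ x x₀ x β w = _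
    simp [ContinuousLinearMap.inCoordinates]
  have h₂ : ∀ (γ : DualBundle V₁ x) w,
      (trivializationAt (F₁ →L[ℝ] ℝ) (DualBundle V₁) x₀).continuousLinearMapAt ℝ x γ w
        = γ ((trivializationAt F₁ V₁ x₀).symmL ℝ x w) := by
    intro γ w
    rw [Trivialization.continuousLinearMapAt_apply, Trivialization.coe_linearMapAt_of_mem _ hb₁]
    change ContinuousLinearMap.inCoordinates F₁ V₁ ℝ (Bundle.Trivial M ℝ) x₀ x x₀ x γ w = _
    simp [ContinuousLinearMap.inCoordinates]
  change (trivializationAt (F₁ →L[ℝ] ℝ) (DualBundle V₁) x₀).continuousLinearMapAt ℝ x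
    (β.comp (Φ x)) v = α ((trivializationAt F₂ V₂ x₀).continuousLinearMapAt ℝ x
      (Φ x ((trivializationAt F₁ V₁ x₀).symmL ℝ x v)))
  rw [h₁, h₂, Trivialization.symmL_continuousLinearMapAt _ hx]
  rfl

/-- The transpose `Φ* : V₂* → V₁*` of a bundle map, `Φ* α = α ∘ Φ` fibrewise. -/
def BundleMap.transpose (Φ : BundleMap I F₁ V₁ F₂ V₂) :
    BundleMap I (F₂ →L[ℝ] ℝ) (DualBundle V₂) (F₁ →L[ℝ] ℝ) (DualBundle V₁) :=
  ⟨fun x ↦ (Φ x).precomp (Bundle.Trivial M ℝ x), Φ.transpose_contMDiff⟩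

end BundleMaps

variable (F : Type*) [NormedAddCommGroup F] [NormedSpace ℝ F]
  (V : M → Type*) [TopologicalSpace (TotalSpace F V)]
  [∀ x, AddCommGroup (V x)] [∀ x, Module ℝ (V x)] [∀ x, TopologicalSpace (V x)]
  [∀ x, IsTopologicalAddGroup (V x)] [∀ x, ContinuousSMul ℝ (V x)]
  [FiberBundle F V] [VectorBundle ℝ F V] [IsManifold I ∞ M]

/-- The data of a Lie algebroid on the vector bundle `V → M`, without its axioms: a bundle map
`V → TM` (the anchor) and a bracket on the space of smooth sections. -/
structure AnchoredBracket where
  /-- the anchor `ρ : V → TM` -/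
  anchor : BundleMap I F V E (TangentSpace I : M → Type _)
  /-- the bracket on sections -/
  bracket : Cₛ^∞⟮I; F, V⟯ → Cₛ^∞⟮I; F, V⟯ → Cₛ^∞⟮I; F, V⟯

namespace AnchoredBracket

variable {I F V}
variable (L : AnchoredBracket I F V)

/-- The derivative `ρ(X) f` of a function along the vector field `ρ(X)`. -/
def der (X : Cₛ^∞⟮I; F, V⟯) (f : M → ℝ) : M → ℝ :=
  fun x ↦ mfderiv I 𝓘(ℝ, ℝ) f x (L.anchor x (X x))

/-- The Lie algebroid axioms: the bracket is a Lie bracket on the real vector space of sections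
(homogeneity in real scalars being a case of the Leibniz rule), and it satisfies
`[X, f Y] = f [X, Y] + (ρ(X) f) Y`. -/
structure IsLieAlgebroid : Prop where
  bracket_add : ∀ X Y Z, L.bracket X (Y + Z) = L.bracket X Y + L.bracket X Z
  bracket_skew : ∀ X Y, L.bracket X Y = -L.bracket Y X
  jacobi : ∀ X Y Z, L.bracket X (L.bracket Y Z) + L.bracket Y (L.bracket Z X)
    + L.bracket Z (L.bracket X Y) = 0
  leibniz : ∀ (X Y : Cₛ^∞⟮I; F, V⟯) (f : M → ℝ) (hf : ContMDiff I 𝓘(ℝ, ℝ) ∞ f) (x : M),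
    L.bracket X ⟨f • ⇑Y, hf.smul_section Y.contMDiff⟩ x
      = f x • L.bracket X Y x + L.der X f x • Y x

/-- The pairing `⟨η, X⟩` of a 1-form with a section, as a function on `M`. -/
def pairing (η : OneForm I F V) (X : Cₛ^∞⟮I; F, V⟯) : M → ℝ := fun x ↦ η x (X x)

/-- The Lie algebroid differential of a 1-form,
`dη(X, Y) = ρ(X)⟨η, Y⟩ - ρ(Y)⟨η, X⟩ - ⟨η, [X, Y]⟩`. -/
def dForm (η : OneForm I F V) (X Y : Cₛ^∞⟮I; F, V⟯) : M → ℝ :=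
  L.der X (pairing η Y) - L.der Y (pairing η X) - pairing η (L.bracket X Y)

/-- The `φ`-differential of a function evaluated on a section, `(dᵠ f)(Y) = ρ(Y) f + f ⟨φ, Y⟩`. -/
def dPhiFun (φ : OneForm I F V) (f : M → ℝ) (Y : Cₛ^∞⟮I; F, V⟯) : M → ℝ :=
  L.der Y f + f * pairing φ Y

/-- The `φ`-differential of a 1-form, `dᵠ η = dη + φ ∧ η`, evaluated on two sections. -/
def dPhiForm (φ η : OneForm I F V) (X Y : Cₛ^∞⟮I; F, V⟯) : M → ℝ :=
  L.dForm η X Y + (pairing φ X * pairing η Y - pairing φ Y * pairing η X)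

/-- The `φ`-Lie derivative of a 1-form, `ℒᵠ_X η = i_X dᵠ η + dᵠ i_X η`, evaluated on the
section `Y`. -/
def liePhi (φ : OneForm I F V) (X : Cₛ^∞⟮I; F, V⟯) (η : OneForm I F V) (Y : Cₛ^∞⟮I; F, V⟯) :
    M → ℝ :=
  L.dPhiForm φ η X Y + L.dPhiFun φ (pairing η X) Y

/-- `φ` is a 1-cocycle in the Lie algebroid cohomology with trivial coefficients: `dφ = 0`. -/
def IsCocycle (φ : OneForm I F V) : Prop := ∀ X Y, L.dForm φ X Y = 0

/-- The bracket `[X, Y]_N = [N X, Y] + [X, N Y] - N [X, Y]`. -/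
def deformedBracket (N : BundleMap I F V F V) (X Y : Cₛ^∞⟮I; F, V⟯) : Cₛ^∞⟮I; F, V⟯ :=
  L.bracket (N.onSections X) Y + L.bracket X (N.onSections Y) - N.onSections (L.bracket X Y)

/-- The structure `([·, ·]_N, ρ ∘ N)` on `V`. -/
def deform (N : BundleMap I F V F V) : AnchoredBracket I F V where
  anchor := L.anchor.comp N
  bracket := L.deformedBracket N

/-- A bundle map `N : V → V` is a Nijenhuis operator if its torsion
`[N X, N Y] - N [X, Y]_N` vanishes. -/
def IsNijenhuis (N : BundleMap I F V F V) : Prop :=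
  ∀ X Y, L.bracket (N.onSections X) (N.onSections Y) - N.onSections (L.deformedBracket N X Y) = 0

/-- A bundle map `S : V* → V` viewed as the contravariant 2-tensor `S(α, β) = ⟨β, S α⟩`. -/
def tensor (S : BundleMap I (F →L[ℝ] ℝ) (DualBundle V) F V) (α β : OneForm I F V) : M → ℝ :=
  pairing β (S.onSections α)

/-- A bivector `P`, a section of `Λ² V`, is given by the bundle map `P♯ : V* → V` with
`⟨β, P♯ α⟩ = P(α, β)`; this predicate says that the 2-tensor `P` is skew-symmetric. -/
def IsBivector (P : BundleMap I (F →L[ℝ] ℝ) (DualBundle V) F V) : Prop :=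
  ∀ (x : M) (α β : DualBundle V x), (show ℝ from β (P x α)) = -(show ℝ from α (P x β))

/-- The Schouten bracket `[P, Q]` of two bivectors, a trivector, evaluated on three 1-forms. It is
the biderivation extending the bracket of sections: on decomposable bivectors,
`[X ∧ Y, Z ∧ W] = [X, Z] ∧ Y ∧ W - [X, W] ∧ Y ∧ Z - [Y, Z] ∧ X ∧ W + [Y, W] ∧ X ∧ Z`. -/
def schouten (P Q : BundleMap I (F →L[ℝ] ℝ) (DualBundle V) F V) (α β γ : OneForm I F V) : M → ℝ :=
  let c (α β γ : OneForm I F V) : M → ℝ :=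
    pairing α (L.bracket (P.onSections β) (Q.onSections γ))
      + pairing α (L.bracket (Q.onSections β) (P.onSections γ))
      - L.der (P.onSections α) (tensor Q β γ) - L.der (Q.onSections α) (tensor P β γ)
  c α β γ + c β γ α + c γ α β

/-- The trivector `X ∧ Q`, for a section `X` and a bivector `Q`, evaluated on three 1-forms. -/
def wedge (X : Cₛ^∞⟮I; F, V⟯) (Q : BundleMap I (F →L[ℝ] ℝ) (DualBundle V) F V)
    (α β γ : OneForm I F V) : M → ℝ :=
  pairing α X * tensor Q β γ + pairing β X * tensor Q γ α + pairing γ X * tensor Q α β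

/-- The Schouten-Jacobi bracket `[P, Q]ᵠ = [P, Q] + P ∧ i_φ Q + i_φ P ∧ Q` of two bivectors,
where `i_φ P = P♯ φ`. -/
def schoutenJacobi (φ : OneForm I F V) (P Q : BundleMap I (F →L[ℝ] ℝ) (DualBundle V) F V)
    (α β γ : OneForm I F V) : M → ℝ :=
  L.schouten P Q α β γ + wedge (Q.onSections φ) P α β γ + wedge (P.onSections φ) Q α β γ

/-- `P` is a Jacobi bivector on the Jacobi algebroid `(V, φ)`: `[P, P]ᵠ = 0`. -/
structure IsJacobiBivector (φ : OneForm I F V)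
    (P : BundleMap I (F →L[ℝ] ℝ) (DualBundle V) F V) : Prop where
  isBivector : IsBivector P
  schoutenJacobi_eq_zero : ∀ α β γ, L.schoutenJacobi φ P P α β γ = 0

/-- The 1-form `[α, β]_P = ℒᵠ_{P♯ α} β - ℒᵠ_{P♯ β} α - dᵠ(P(α, β))`, evaluated on the section
`Y`. -/
def dualBracket (φ : OneForm I F V) (P : BundleMap I (F →L[ℝ] ℝ) (DualBundle V) F V)
    (α β : OneForm I F V) (Y : Cₛ^∞⟮I; F, V⟯) : M → ℝ :=
  L.liePhi φ (P.onSections α) β Y - L.liePhi φ (P.onSections β) α Y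
    - L.dPhiFun φ (tensor P α β) Y

/-- `D` is the structure on `V*` induced by `P`, with bracket `[·, ·]_P` and anchor `ρ ∘ P♯`. -/
structure IsDualStructure (φ : OneForm I F V)
    (P : BundleMap I (F →L[ℝ] ℝ) (DualBundle V) F V)
    (D : AnchoredBracket I (F →L[ℝ] ℝ) (DualBundle V)) : Prop where
  bracket_eq : ∀ α β Y, pairing (D.bracket α β) Y = L.dualBracket φ P α β Y
  anchor_eq : D.anchor = L.anchor.comp P

/-- `(V, φ, P, N)` is a Jacobi-Nijenhuis algebroid: `(V, φ)` is a Jacobi algebroid, `P` is a Jacobi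
bivector, `N` is a Nijenhuis operator, `N P = P N*`, and the bracket `[·, ·]_{NP}` obtained from
`(V, φ)` by `N P` coincides with the bracket obtained from `(V_N, N* φ)` by `P`. -/
structure IsJacobiNijenhuis (φ : OneForm I F V)
    (P : BundleMap I (F →L[ℝ] ℝ) (DualBundle V) F V) (N : BundleMap I F V F V) : Prop where
  isLieAlgebroid : L.IsLieAlgebroid
  isCocycle : L.IsCocycle φ
  isJacobiBivector : L.IsJacobiBivector φ P
  isNijenhuis : L.IsNijenhuis N
  comp_eq : N.comp P = P.comp N.transpose
  bracket_eq : ∀ α β Y, L.dualBracket φ (N.comp P) α β Y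
    = (L.deform N).dualBracket (N.transpose.onSections φ) P α β Y

end AnchoredBracket

end JacobiAlgebroids

/-!
For a 1-cocycle `φ` write `D_X f = ρ(X) f + f ⟨φ, X⟩`; this is the covariant derivative of a flat
connection on the trivial line bundle, that is, `D_[X,Y] = D_X D_Y - D_Y D_X`. In these terms
`ℒᵠ_X η (Y) = D_X ⟨η, Y⟩ - ⟨η, [X, Y]⟩`, and the bracket of 1-forms becomes

`[α, β]_P(Y) = D_{Pα} ⟨β, Y⟩ - ⟨β, [Pα, Y]⟩ - D_{Pβ} ⟨α, Y⟩ + ⟨α, [Pβ, Y]⟩ - D_Y P(α, β)`.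

This expression is `C^∞(M)`-linear in `Y`, so it is the pairing with a smooth 1-form
(`exists_oneForm_of_funSMul_linear`, through bump functions and local frames). The vanishing of the
cyclic sum of `⟨α, [Pβ, Pγ]⟩ - D_{Pα} P(β, γ)`, which is half of `[P, P]ᵠ(α, β, γ)`, says exactly
that `P♯` intertwines the brackets (`twistedDual_map_eq`). With this, the Jacobiator of `[·, ·]_P`
evaluated on `Y` reduces, by flatness of `D` and the Jacobi identity of `A`, to `-D_Y` of the same
cyclic sum taken twice (`twistedDual_jacobi`). Flatness of `D` needs the anchor of `A` to be a
homomorphism, which is a consequence of the other axioms (`smoothDer_bracket`).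

For the Nijenhuis property, the difference of `[α, β]_{NP}` and `[α, β]_P^N` is the concomitant

`C(α, β)(Y) = ⟨β, [Pα, NY] - N[Pα, Y]⟩ - ⟨α, [Pβ, NY] - N[Pβ, Y]⟩ - D_Y⟨β, NPα⟩ + D_{NY}⟨β, Pα⟩`,

and the torsion of `N*` at `(α, β)`, evaluated on `Y`, equals `C(α, N*β)(Y) - C(α, β)(NY)` as soon
as the torsion of `N` vanishes and `P N* = N P` (`twistedDual_nijenhuis`).

All these identities only involve the pairing, the bracket of sections and the operators `D_X`, so
they are proved for arbitrary additive data and then applied to the ring of smooth functions.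
-/

/-! ### Algebraic identities for the bracket of 1-forms -/

section Algebra

variable {R Γ Ω : Type*} [CommRing R] [AddCommGroup Γ]

/-- `P` intertwines the bracket `B` of 1-forms with the bracket of sections, if the cyclic sum
expressing `[P, P]ᵠ = 0` vanishes: pairing `P (B α β) - [P α, P β]` with `γ` gives, by skewness of
`P`, minus that cyclic sum. -/
theorem twistedDual_map_eq {pair : Ω → Γ → R} {br : Γ → Γ → Γ} {D : Γ → R → R} {P : Ω → Γ}
    {B : Ω → Ω → Ω}
    (hDneg : ∀ X f, D X (-f) = -D X f)
    (hpair : ∀ α X Y, pair α (X - Y) = pair α X - pair α Y)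
    (hsep : ∀ X, (∀ α, pair α X = 0) → X = 0)
    (hskew : ∀ X Y α, pair α (br X Y) = -pair α (br Y X))
    (hP : ∀ α β, pair β (P α) = -pair α (P β))
    (hB : ∀ α β Y, pair (B α β) Y = D (P α) (pair β Y) - pair β (br (P α) Y)
      - (D (P β) (pair α Y) - pair α (br (P β) Y)) - D Y (pair β (P α)))
    (hJ : ∀ α β γ, pair α (br (P β) (P γ)) - D (P α) (pair γ (P β))
      + (pair β (br (P γ) (P α)) - D (P β) (pair α (P γ)))
      + (pair γ (br (P α) (P β)) - D (P γ) (pair β (P α))) = 0) (α β : Ω) :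
    P (B α β) = br (P α) (P β) := by
  refine sub_eq_zero.1 (hsep _ fun γ ↦ ?_)
  have h := hJ α β γ
  rw [hpair, hP (B α β) γ, hB, hP γ β, hDneg, hskew (P β) (P γ) α] 
  rw [hskew (P β) (P γ) α, hskew (P γ) (P α) β] at h
  linear_combination -h

/-- The Jacobi identity for the bracket `B` of 1-forms, for flat `D`. -/
theorem twistedDual_jacobi {pair : Ω → Γ → R} {br : Γ → Γ → Γ} {D : Γ → R → R} {P : Ω → Γ}
    {B : Ω → Ω → Ω}
    (hDsub : ∀ X f g, D X (f - g) = D X f - D X g)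
    (hpair : ∀ α X Y, pair α (X - Y) = pair α X - pair α Y)
    (hskew : ∀ X Y α, pair α (br X Y) = -pair α (br Y X))
    (hjac : ∀ X Y Z, br (br X Y) Z = br X (br Y Z) - br Y (br X Z))
    (hflat : ∀ X Y f, D (br X Y) f = D X (D Y f) - D Y (D X f))
    (hP : ∀ α β, pair β (P α) = -pair α (P β))
    (hB : ∀ α β Y, pair (B α β) Y = D (P α) (pair β Y) - pair β (br (P α) Y)
      - (D (P β) (pair α Y) - pair α (br (P β) Y)) - D Y (pair β (P α)))
    (hJ : ∀ α β γ, pair α (br (P β) (P γ)) - D (P α) (pair γ (P β))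
      + (pair β (br (P γ) (P α)) - D (P β) (pair α (P γ)))
      + (pair γ (br (P α) (P β)) - D (P γ) (pair β (P α))) = 0)
    (hhom : ∀ α β, P (B α β) = br (P α) (P β)) (α β γ : Ω) (Y : Γ) :
    pair (B α (B β γ)) Y + pair (B β (B γ α)) Y + pair (B γ (B α β)) Y = 0 := by
  have hD0 : ∀ X, D X 0 = 0 := fun X ↦ by simpa using hDsub X 0 0
  have hDneg : ∀ X f, D X (-f) = -D X f := fun X f ↦ by
    simpa [hD0] using hDsub X 0 f
  have hDadd : ∀ X f g, D X (f + g) = D X f + D X g := fun X f g ↦ by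
    simpa [hDneg] using hDsub X f (-g)
  have h := congrArg (D Y) (hJ α β γ)
  have e₁ := hP β α
  have e₂ := hP γ β
  have e₃ := hP α γ
  have s₁ := hskew (P β) (P α) γ
  have s₂ := hskew (P γ) (P β) α
  have s₃ := hskew (P α) (P γ) β
  simp only [hB, hhom, hDsub, hDadd, hDneg, hD0, hpair, hjac, hflat, e₁, e₂, e₃, s₁, s₂, s₃] at h ⊢
  -- `h` is `D Y` applied to the cyclic sum, which occurs twice in the Jacobiator.
  linear_combination -2 * h

variable [AddCommGroup Ω]

/-- The vanishing of the torsion of the transpose `T` of `N`. The hypothesis `hC` is the equality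
of the two brackets `[·, ·]_{NP}` and `[·, ·]_P^N`; it is used at `(α, β, N Y)` and at
`(α, T β, Y)`. -/
theorem twistedDual_nijenhuis {pair : Ω → Γ → R} {br : Γ → Γ → Γ} {D : Γ → R → R} {P : Ω → Γ}
    {B : Ω → Ω → Ω} {N : Γ → Γ} {T : Ω → Ω}
    (hpair : ∀ α X Y, pair α (X - Y) = pair α X - pair α Y)
    (hpair' : ∀ α X Y, pair α (X + Y) = pair α X + pair α Y)
    (hpairl : ∀ α β X, pair (α - β) X = pair α X - pair β X)
    (hpairl' : ∀ α β X, pair (α + β) X = pair α X + pair β X)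
    (hN : ∀ X Y, N (X - Y) = N X - N Y)
    (hN' : ∀ X Y, N (X + Y) = N X + N Y)
    (hT : ∀ α X, pair (T α) X = pair α (N X))
    (hPT : ∀ α, P (T α) = N (P α))
    (hNij : ∀ X Y, br (N X) (N Y) = N (br (N X) Y + br X (N Y) - N (br X Y)))
    (hB : ∀ α β Y, pair (B α β) Y = D (P α) (pair β Y) - pair β (br (P α) Y)
      - (D (P β) (pair α Y) - pair α (br (P β) Y)) - D Y (pair β (P α)))
    (hC : ∀ α β Y, pair β (br (P α) (N Y)) - pair β (N (br (P α) Y)) - pair α (br (P β) (N Y))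
      + pair α (N (br (P β) Y)) - D Y (pair β (N (P α))) + D (N Y) (pair β (P α)) = 0)
    (α β : Ω) (Y : Γ) :
    pair (B (T α) (T β)) Y = pair (T (B (T α) β + B α (T β) - T (B α β))) Y := by
  have h₁ := hC α β (N Y)
  have h₂ := hC α (T β) Y
  simp only [hT, hPT, hpair, hpair', hpairl, hpairl', hB, hN, hN', hNij] at h₁ h₂ ⊢
  linear_combination h₂ - h₁

end Algebra

/-! ### Sections, bump functions and tensoriality -/

noncomputable section Geometry

variable {E : Type*} [NormedAddCommGroup E] [NormedSpace ℝ E]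
  {H : Type*} [TopologicalSpace H] {I : ModelWithCorners ℝ E H}
  {M : Type*} [TopologicalSpace M] [ChartedSpace H M]
  {F : Type*} [NormedAddCommGroup F] [NormedSpace ℝ F]
  {V : M → Type*} [TopologicalSpace (TotalSpace F V)]
  [∀ x, AddCommGroup (V x)] [∀ x, Module ℝ (V x)] [∀ x, TopologicalSpace (V x)]
  [FiberBundle F V] [VectorBundle ℝ F V]

/-- The product `f Y` of a smooth function and a smooth section. -/
def ContMDiffSection.funSMul (f : C^∞⟮I, M; ℝ⟯) (Y : Cₛ^∞⟮I; F, V⟯) : Cₛ^∞⟮I; F, V⟯ :=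
  ⟨⇑f • ⇑Y, f.contMDiff.smul_section Y.contMDiff⟩

@[simp]
theorem ContMDiffSection.funSMul_apply (f : C^∞⟮I, M; ℝ⟯) (Y : Cₛ^∞⟮I; F, V⟯) (x : M) :
    Y.funSMul f x = f x • Y x := rfl

section Extension

variable [FiniteDimensional ℝ E] [T2Space M]

theorem exists_bump_tsupport_subset [IsManifold I ∞ M] {x₀ : M} {u : Set M} (hu : u ∈ nhds x₀) :
    ∃ ψ : C^∞⟮I, M; ℝ⟯, tsupport ψ ⊆ u ∧ ψ =ᶠ[nhds x₀] 1 := by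
  obtain ⟨ψ, -, hψ⟩ := (SmoothBumpFunction.nhds_basis_tsupport (I := I) x₀).mem_iff.1 hu
  exact ⟨⟨ψ, ψ.contMDiff⟩, hψ, ψ.eventuallyEq_one⟩

variable [IsManifold I ∞ M]

theorem exists_contMDiffSection_eventuallyEq {x₀ : M} {s : Π x, V x} {u : Set M} (hu : IsOpen u)
    (hx₀ : x₀ ∈ u)
    (hs : ContMDiffOn I (I.prod 𝓘(ℝ, F)) ∞ (fun x ↦ TotalSpace.mk' F x (s x)) u) :
    ∃ S : Cₛ^∞⟮I; F, V⟯, ∀ᶠ x in nhds x₀, S x = s x := by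
  obtain ⟨ψ, hψ, hψ₁⟩ := exists_bump_tsupport_subset (I := I) (hu.mem_nhds hx₀)
  refine ⟨⟨⇑ψ • s, 
    ContMDiffOn.smul_section_of_tsupport ψ.contMDiff.contMDiffOn hu hψ hs⟩, ?_⟩
  filter_upwards [hψ₁] with x hx
  simp [hx]

variable [ContMDiffVectorBundle ∞ F V I]

theorem exists_contMDiffSection_apply_eq (x₀ : M) (v : V x₀) : ∃ S : Cₛ^∞⟮I; F, V⟯, S x₀ = v := by
  obtain ⟨u, hu, hs⟩ := FiberBundle.exists_contMDiffOn_extend I F (k := ∞) v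
  obtain ⟨u', hu', hu'o, hx⟩ := mem_nhds_iff.1 hu
  obtain ⟨S, hS⟩ := exists_contMDiffSection_eventuallyEq hu'o hx (hs.mono hu')
  exact ⟨S, by simpa using hS.self_of_nhds⟩

variable [FiniteDimensional ℝ F]

/-- A `C^∞(M)`-linear operation on sections is tensorial: it depends only on the value of the
section at the point. -/
theorem eq_zero_of_funSMul_linear {Φ : Cₛ^∞⟮I; F, V⟯ → M → ℝ}
    (hadd : ∀ Y Z, Φ (Y + Z) = Φ Y + Φ Z)
    (hsmul : ∀ (f : C^∞⟮I, M; ℝ⟯) Y, Φ (Y.funSMul f) = f * Φ Y)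
    {Y : Cₛ^∞⟮I; F, V⟯} {x : M} (hY : Y x = 0) : Φ Y x = 0 := by
  have hb1 : ContMDiffVectorBundle 1 F V I := .of_le (n := ∞) (by simp)
  set e := trivializationAt F V x
  have hx : x ∈ e.baseSet := FiberBundle.mem_baseSet_trivializationAt' x
  obtain ⟨ψ, hψ, hψ₁⟩ := exists_bump_tsupport_subset (I := I) (e.open_baseSet.mem_nhds hx)
  let b := Module.finBasis ℝ F
  -- In a local frame `e i` with coefficients `c i` of `Y`, the product `ψ² Y` is the sum of the
  -- `(ψ c i) (ψ e i)`; one factor `ψ` each makes the coefficients and the frame global.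
  let s (i) : Cₛ^∞⟮I; F, V⟯ := ⟨⇑ψ • e.localFrame b i,
    ContMDiffOn.smul_section_of_tsupport ψ.contMDiff.contMDiffOn e.open_baseSet hψ
      (e.contMDiffOn_localFrame_baseSet ∞ b i)⟩
  let c (i) : M → ℝ := fun y ↦ e.localFrameCoeff I b i y (Y y)
  have hc (i) : ContMDiff I 𝓘(ℝ, ℝ) ∞ (fun y ↦ ψ y * c i y) := by
    refine contMDiff_of_tsupport fun y hy ↦ ?_
    have hy' : y ∈ e.baseSet := hψ (tsupport_mul_subset_left hy)
    exact ψ.contMDiff.contMDiffAt.mul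
      (contMDiffAt_localFrameCoeff b hy' Y.contMDiff.contMDiffAt i)
  let g (i) : C^∞⟮I, M; ℝ⟯ := ⟨fun y ↦ ψ y * c i y, hc i⟩
  have hg (i y) : g i y = ψ y * c i y := rfl
  have hsum : Y.funSMul (ψ * ψ) = ∑ i, (s i).funSMul (g i) := by
    have hcoe : ⇑(∑ i, (s i).funSMul (g i)) = ∑ i, ⇑((s i).funSMul (g i)) :=
      map_sum (ContMDiffSection.coeAddHom I F ∞ V) _ _
    have hs (i y) : s i y = ψ y • e.localFrame b i y := rfl
    ext y
    rw [hcoe, Finset.sum_apply]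
    simp only [ContMDiffSection.funSMul_apply, hg, hs, ContMDiffMap.coe_mul, Pi.mul_apply]
    by_cases hy : y ∈ e.baseSet
    · conv_lhs => rw [Trivialization.eq_sum_localFrameCoeff_smul (I := I) (b := b) (s := ⇑Y) hy]
      rw [Finset.smul_sum]
      refine Finset.sum_congr rfl fun i _ ↦ ?_
      rw [smul_smul, smul_smul]
      congr 1
      ring
    · have : ψ y = 0 := image_eq_zero_of_notMem_tsupport fun h ↦ hy (hψ h)
      simp [this]
  let Φ' : Cₛ^∞⟮I; F, V⟯ →+ (M → ℝ) := AddMonoidHom.mk' Φ hadd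
  have h₁ : Φ (Y.funSMul (ψ * ψ)) x = Φ Y x := by
    rw [hsmul]
    simp [hψ₁.self_of_nhds]
  rw [← h₁, hsum]
  change Φ' _ x = 0
  rw [map_sum, Finset.sum_apply]
  refine Finset.sum_eq_zero fun i _ ↦ ?_
  change Φ _ x = 0
  rw [hsmul, Pi.mul_apply, hg]
  simp [c, hY]

/-- A `C^∞(M)`-linear map from sections to smooth functions is the pairing with a 1-form. -/
theorem exists_oneForm_of_funSMul_linear {Φ : Cₛ^∞⟮I; F, V⟯ → M → ℝ}
    (hadd : ∀ Y Z, Φ (Y + Z) = Φ Y + Φ Z)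
    (hsmul : ∀ (f : C^∞⟮I, M; ℝ⟯) Y, Φ (Y.funSMul f) = f * Φ Y)
    (hsmooth : ∀ Y, ContMDiff I 𝓘(ℝ, ℝ) ∞ (Φ Y)) :
    ∃ η : OneForm I F V, ∀ Y, AnchoredBracket.pairing η Y = Φ Y := by
  choose ext hext using fun (x : M) (v : V x) ↦
    exists_contMDiffSection_apply_eq (I := I) (F := F) x v
  let Φ' : Cₛ^∞⟮I; F, V⟯ →+ (M → ℝ) := AddMonoidHom.mk' Φ hadd
  have hval {x : M} {Y Z : Cₛ^∞⟮I; F, V⟯} (h : Y x = Z x) : Φ Y x = Φ Z x := by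
    have := eq_zero_of_funSMul_linear hadd hsmul (Y := Y - Z) (x := x) (by simp [h])
    have h' : Φ (Y - Z) = Φ Y - Φ Z := map_sub Φ' Y Z
    rwa [h', Pi.sub_apply, sub_eq_zero] at this
  let η₀ (x : M) : V x →ₗ[ℝ] ℝ :=
    { toFun := fun v ↦ Φ (ext x v) x
      map_add' := fun v w ↦ by
        rw [← Pi.add_apply, ← hadd]
        exact hval (by simp [hext])
      map_smul' := fun c v ↦ by
        have := congrFun (hsmul (ContMDiffMap.const c) (ext x v)) x
        rw [RingHom.id_apply, smul_eq_mul]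
        refine Eq.trans (hval ?_) this
        rw [ContMDiffSection.funSMul_apply, hext, hext]
        rfl }
  let η (x : M) : DualBundle V x :=
    let e := VectorBundle.continuousLinearEquivAt ℝ F V x
    ((η₀ x).comp (e.symm : F →ₗ[ℝ] V x)).toContinuousLinearMap.comp (e : V x →L[ℝ] F)
  have hη (x : M) (Y : Cₛ^∞⟮I; F, V⟯) : η x (Y x) = Φ Y x := by
    have : η x (Y x) = η₀ x (Y x) := by
      change η₀ x ((VectorBundle.continuousLinearEquivAt ℝ F V x).symm
        (VectorBundle.continuousLinearEquivAt ℝ F V x (Y x))) = _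
      rw [ContinuousLinearEquiv.symm_apply_apply]
    rw [this]
    exact hval (hext x _)
  refine ⟨⟨η, fun x₀ ↦ (contMDiffAt_hom_bundle _).2 ⟨contMDiffAt_id, ?_⟩⟩,
    fun Y ↦ funext fun x ↦ hη x Y⟩
  set e := trivializationAt F V x₀
  have hx₀ : x₀ ∈ e.baseSet := FiberBundle.mem_baseSet_trivializationAt' x₀
  let b := Module.finBasis ℝ F
  choose s hs using fun i ↦ exists_contMDiffSection_eventuallyEq e.open_baseSet hx₀
    (e.contMDiffOn_localFrame_baseSet (I := I) ∞ b i)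
  have key : ContMDiffAt I 𝓘(ℝ, F →L[ℝ] ℝ) ∞
      (fun x ↦ ∑ i, Φ (s i) x • LinearMap.toContinuousLinearMap (b.coord i)) x₀ :=
    contMDiffAt_finsetSum fun i _ ↦ ((hsmooth (s i)).contMDiffAt).smul contMDiffAt_const
  refine key.congr_of_eventuallyEq ?_
  filter_upwards [e.open_baseSet.mem_nhds hx₀, Filter.eventually_all.2 hs] with x hx hsx
  apply ContinuousLinearMap.coe_injective
  refine b.ext fun i ↦ ?_
  have h₁ : ContinuousLinearMap.inCoordinates F V ℝ (Bundle.Trivial M ℝ) x₀ x x₀ x (η x) (b i)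
      = η x (e.symmL ℝ x (b i)) := by
    simp [ContinuousLinearMap.inCoordinates, e]
  have h₂ : e.symmL ℝ x (b i) = s i x := by
    rw [hsx i]
    simp [hx, Trivialization.basisAt, Trivialization.symmL_apply]
  simp only [ContinuousLinearMap.coe_coe]
  rw [h₁, h₂, hη]
  simp [Finsupp.single_apply]

end Extension

end Geometry

/-! ### Calculus on smooth functions -/

noncomputable section Calculus

variable {E : Type*} [NormedAddCommGroup E] [NormedSpace ℝ E]
  {H : Type*} [TopologicalSpace H] {I : ModelWithCorners ℝ E H}
  {M : Type*} [TopologicalSpace M] [ChartedSpace H M]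
  {F : Type*} [NormedAddCommGroup F] [NormedSpace ℝ F]
  {V : M → Type*} [TopologicalSpace (TotalSpace F V)]
  [∀ x, AddCommGroup (V x)] [∀ x, Module ℝ (V x)] [∀ x, TopologicalSpace (V x)]
  [FiberBundle F V] [VectorBundle ℝ F V]

namespace AnchoredBracket

/-- The pairing of a 1-form with a section, as a smooth function. -/
def smoothPairing (η : OneForm I F V) (X : Cₛ^∞⟮I; F, V⟯) : C^∞⟮I, M; ℝ⟯ :=
  ⟨pairing η X, fun x ↦
    ((contMDiffAt_section _).1 (η.contMDiff.clm_bundle_apply (F₂ := ℝ) (E₂ := Bundle.Trivial M ℝ)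
      X.contMDiff x) :)⟩

theorem coe_smoothPairing (η : OneForm I F V) (X : Cₛ^∞⟮I; F, V⟯) :
    ⇑(smoothPairing η X) = pairing η X := rfl

theorem smoothPairing_add (η : OneForm I F V) (X Y : Cₛ^∞⟮I; F, V⟯) :
    smoothPairing η (X + Y) = smoothPairing η X + smoothPairing η Y :=
  DFunLike.ext _ _ fun x ↦ map_add (η x) (X x) (Y x)

theorem smoothPairing_sub (η : OneForm I F V) (X Y : Cₛ^∞⟮I; F, V⟯) :
    smoothPairing η (X - Y) = smoothPairing η X - smoothPairing η Y :=
  DFunLike.ext _ _ fun x ↦ map_sub (η x) (X x) (Y x)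

theorem smoothPairing_neg (η : OneForm I F V) (X : Cₛ^∞⟮I; F, V⟯) :
    smoothPairing η (-X) = -smoothPairing η X :=
  DFunLike.ext _ _ fun x ↦ map_neg (η x) (X x)

theorem smoothPairing_funSMul (η : OneForm I F V) (f : C^∞⟮I, M; ℝ⟯) (X : Cₛ^∞⟮I; F, V⟯) :
    smoothPairing η (X.funSMul f) = f * smoothPairing η X :=
  DFunLike.ext _ _ fun x ↦ map_smul (η x) (f x) (X x)

theorem add_smoothPairing (η θ : OneForm I F V) (X : Cₛ^∞⟮I; F, V⟯) :
    smoothPairing (η + θ) X = smoothPairing η X + smoothPairing θ X := rfl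

theorem sub_smoothPairing (η θ : OneForm I F V) (X : Cₛ^∞⟮I; F, V⟯) :
    smoothPairing (η - θ) X = smoothPairing η X - smoothPairing θ X := rfl

theorem neg_smoothPairing (η : OneForm I F V) (X : Cₛ^∞⟮I; F, V⟯) :
    smoothPairing (-η) X = -smoothPairing η X := rfl

theorem funSMul_smoothPairing (η : OneForm I F V) (f : C^∞⟮I, M; ℝ⟯) (X : Cₛ^∞⟮I; F, V⟯) :
    smoothPairing (η.funSMul f) X = f * smoothPairing η X := rfl

section Separation

variable [FiniteDimensional ℝ E] [T2Space M] [IsManifold I ∞ M] [ContMDiffVectorBundle ∞ F V I]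

theorem oneForm_ext {η θ : OneForm I F V}
    (h : ∀ Y, smoothPairing η Y = smoothPairing θ Y) : η = θ := by
  ext x v
  obtain ⟨Y, rfl⟩ := exists_contMDiffSection_apply_eq (I := I) (F := F) x v
  exact DFunLike.congr_fun (h Y) x

theorem section_eq_zero_of_smoothPairing {X : Cₛ^∞⟮I; F, V⟯}
    (h : ∀ η, smoothPairing η X = 0) : X = 0 := by
  ext x
  by_contra hX
  let e := VectorBundle.continuousLinearEquivAt ℝ F V x
  obtain ⟨g, hg⟩ := SeparatingDual.exists_ne_zero (R := ℝ) (e.map_ne_zero_iff.2 hX)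
  obtain ⟨η, hη⟩ := exists_contMDiffSection_apply_eq (I := I) (F := F →L[ℝ] ℝ)
    (V := DualBundle V) x (g.comp (e : V x →L[ℝ] F))
  have h' : η x (X x) = 0 := DFunLike.congr_fun (h η) x
  rw [hη] at h'
  exact hg h'

end Separation

variable [IsManifold I ∞ M]
variable (L : AnchoredBracket I F V)

theorem contMDiff_der (X : Cₛ^∞⟮I; F, V⟯) {f : M → ℝ} (hf : ContMDiff I 𝓘(ℝ, ℝ) ∞ f) :
    ContMDiff I 𝓘(ℝ, ℝ) ∞ (L.der X f) :=
  (contMDiff_snd_tangentBundle_modelSpace ℝ 𝓘(ℝ, ℝ)).comp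
    ((hf.contMDiff_tangentMap (m := ∞) (by simp)).comp (L.anchor.onSections X).contMDiff)

/-- The derivative `ρ(X) f`, as a smooth function. -/
def smoothDer (X : Cₛ^∞⟮I; F, V⟯) (f : C^∞⟮I, M; ℝ⟯) : C^∞⟮I, M; ℝ⟯ :=
  ⟨L.der X f, L.contMDiff_der X f.contMDiff⟩

theorem coe_smoothDer (X : Cₛ^∞⟮I; F, V⟯) (f : C^∞⟮I, M; ℝ⟯) :
    ⇑(L.smoothDer X f) = L.der X f := rfl

theorem smoothDer_apply (X : Cₛ^∞⟮I; F, V⟯) (f : C^∞⟮I, M; ℝ⟯) (x : M) :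
    L.smoothDer X f x = mvfderiv I f x (L.anchor x (X x)) := rfl

theorem smoothDer_add (X : Cₛ^∞⟮I; F, V⟯) (f g : C^∞⟮I, M; ℝ⟯) :
    L.smoothDer X (f + g) = L.smoothDer X f + L.smoothDer X g := by
  ext x
  simp only [smoothDer_apply, ContMDiffMap.coe_add, Pi.add_apply]
  rw [mvfderiv_add f.mdifferentiableAt g.mdifferentiableAt]
  rfl

theorem smoothDer_sub (X : Cₛ^∞⟮I; F, V⟯) (f g : C^∞⟮I, M; ℝ⟯) :
    L.smoothDer X (f - g) = L.smoothDer X f - L.smoothDer X g := by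
  have := L.smoothDer_add X (f - g) g
  rw [sub_add_cancel] at this
  rw [this, add_sub_cancel_right]

theorem smoothDer_mul (X : Cₛ^∞⟮I; F, V⟯) (f g : C^∞⟮I, M; ℝ⟯) :
    L.smoothDer X (f * g) = f * L.smoothDer X g + g * L.smoothDer X f := by
  ext x
  simp only [smoothDer_apply, ContMDiffMap.coe_mul, ContMDiffMap.coe_add, Pi.add_apply,
    Pi.mul_apply]
  rw [mvfderiv_mul f.mdifferentiableAt g.mdifferentiableAt]
  rfl

theorem add_smoothDer (X Y : Cₛ^∞⟮I; F, V⟯) (f : C^∞⟮I, M; ℝ⟯) :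
    L.smoothDer (X + Y) f = L.smoothDer X f + L.smoothDer Y f := by
  ext x
  simp [smoothDer_apply]

theorem funSMul_smoothDer (g : C^∞⟮I, M; ℝ⟯) (X : Cₛ^∞⟮I; F, V⟯) (f : C^∞⟮I, M; ℝ⟯) :
    L.smoothDer (X.funSMul g) f = g * L.smoothDer X f := by
  ext x
  simp [smoothDer_apply]

/-- The operator `f ↦ ρ(X) f + f ⟨φ, X⟩` on smooth functions: the derivative along `X` of the
`V`-connection on the trivial line bundle with connection form `φ`. It is the value of `dᵠ f`
on `X`. -/
def twistedDer (φ : OneForm I F V) (X : Cₛ^∞⟮I; F, V⟯) (f : C^∞⟮I, M; ℝ⟯) : C^∞⟮I, M; ℝ⟯ :=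
  L.smoothDer X f + f * smoothPairing φ X

variable {L} (φ : OneForm I F V)

theorem twistedDer_add (X : Cₛ^∞⟮I; F, V⟯) (f g : C^∞⟮I, M; ℝ⟯) :
    L.twistedDer φ X (f + g) = L.twistedDer φ X f + L.twistedDer φ X g := by
  simp only [twistedDer, smoothDer_add]
  ring

theorem twistedDer_sub (X : Cₛ^∞⟮I; F, V⟯) (f g : C^∞⟮I, M; ℝ⟯) :
    L.twistedDer φ X (f - g) = L.twistedDer φ X f - L.twistedDer φ X g := by
  simp only [twistedDer, smoothDer_sub]
  ring

theorem twistedDer_neg (X : Cₛ^∞⟮I; F, V⟯) (f : C^∞⟮I, M; ℝ⟯) :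
    L.twistedDer φ X (-f) = -L.twistedDer φ X f := by
  have h := twistedDer_sub (L := L) φ X f f
  have h' := twistedDer_sub (L := L) φ X (f - f) f
  rw [h] at h'
  simpa using h'

theorem twistedDer_mul (X : Cₛ^∞⟮I; F, V⟯) (f g : C^∞⟮I, M; ℝ⟯) :
    L.twistedDer φ X (f * g) = f * L.twistedDer φ X g + g * L.smoothDer X f := by
  simp only [twistedDer, smoothDer_mul]
  ring

theorem add_twistedDer (X Y : Cₛ^∞⟮I; F, V⟯) (f : C^∞⟮I, M; ℝ⟯) :
    L.twistedDer φ (X + Y) f = L.twistedDer φ X f + L.twistedDer φ Y f := by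
  simp only [twistedDer, add_smoothDer, smoothPairing_add]
  ring

theorem funSMul_twistedDer (g : C^∞⟮I, M; ℝ⟯) (X : Cₛ^∞⟮I; F, V⟯) (f : C^∞⟮I, M; ℝ⟯) :
    L.twistedDer φ (X.funSMul g) f = g * L.twistedDer φ X f := by
  simp only [twistedDer, funSMul_smoothDer, smoothPairing_funSMul]
  ring

namespace IsLieAlgebroid

variable (hL : L.IsLieAlgebroid)
include hL

theorem add_bracket (X Y Z : Cₛ^∞⟮I; F, V⟯) :
    L.bracket (X + Y) Z = L.bracket X Z + L.bracket Y Z := by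
  rw [hL.bracket_skew, hL.bracket_add, hL.bracket_skew X, hL.bracket_skew Y]
  abel

theorem bracket_neg (X Y : Cₛ^∞⟮I; F, V⟯) : L.bracket X (-Y) = -L.bracket X Y :=
  map_neg (AddMonoidHom.mk' (L.bracket X) (hL.bracket_add X)) Y

theorem bracket_bracket (X Y Z : Cₛ^∞⟮I; F, V⟯) : L.bracket (L.bracket X Y) Z
    = L.bracket X (L.bracket Y Z) - L.bracket Y (L.bracket X Z) := by
  have h := hL.jacobi X Y Z
  rw [hL.bracket_skew Z X, hL.bracket_neg, hL.bracket_skew Z] at h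
  rw [← sub_eq_zero, ← neg_eq_zero, ← h]
  abel

theorem bracket_funSMul (X Y : Cₛ^∞⟮I; F, V⟯) (f : C^∞⟮I, M; ℝ⟯) :
    L.bracket X (Y.funSMul f) = (L.bracket X Y).funSMul f + Y.funSMul (L.smoothDer X f) :=
  ContMDiffSection.ext fun x ↦ hL.leibniz X Y f f.contMDiff x

theorem funSMul_bracket (X Y : Cₛ^∞⟮I; F, V⟯) (f : C^∞⟮I, M; ℝ⟯) :
    L.bracket (X.funSMul f) Y = (L.bracket X Y).funSMul f - X.funSMul (L.smoothDer Y f) := by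
  rw [hL.bracket_skew, hL.bracket_funSMul, hL.bracket_skew Y X]
  ext x
  simp
  abel

section Flat

variable [FiniteDimensional ℝ E] [T2Space M] [ContMDiffVectorBundle ∞ F V I]

/-- The anchor is a homomorphism of Lie algebras. This follows from the Jacobi identity for
`X`, `Y` and `f Z` together with the Leibniz rule, at points where some section `Z` does not
vanish; at the other points the fibre is zero. -/
theorem smoothDer_bracket (X Y : Cₛ^∞⟮I; F, V⟯) (f : C^∞⟮I, M; ℝ⟯) :
    L.smoothDer (L.bracket X Y) f
      = L.smoothDer X (L.smoothDer Y f) - L.smoothDer Y (L.smoothDer X f) := by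
  ext x
  by_cases hx : ∃ v : V x, v ≠ 0
  · obtain ⟨v, hv⟩ := hx
    obtain ⟨Z, rfl⟩ := exists_contMDiffSection_apply_eq (I := I) (F := F) x v
    have h := hL.bracket_bracket X Y (Z.funSMul f)
    simp only [hL.bracket_funSMul, hL.bracket_add] at h
    rw [hL.bracket_bracket X Y Z] at h
    have h' := DFunLike.congr_fun h x
    simp only [ContMDiffSection.coe_add, ContMDiffSection.coe_sub, Pi.add_apply, Pi.sub_apply,
      ContMDiffSection.funSMul_apply] at h'
    rw [ContMDiffMap.coe_sub, Pi.sub_apply, ← sub_eq_zero]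
    refine (smul_eq_zero_iff_left hv).1 ?_
    rw [← sub_eq_zero] at h'
    rw [← h']
    module
  · have hx' (v : V x) : v = 0 := by
      by_contra hv
      exact hx ⟨v, hv⟩
    have h0 (W : Cₛ^∞⟮I; F, V⟯) (g : C^∞⟮I, M; ℝ⟯) : L.smoothDer W g x = 0 := by
      rw [smoothDer_apply, hx' (W x), map_zero, map_zero]
    rw [ContMDiffMap.coe_sub, Pi.sub_apply, h0, h0, h0, sub_zero]

/-- For a cocycle `φ` the connection `Dᵠ` on the trivial line bundle is flat. -/
theorem twistedDer_bracket {φ : OneForm I F V} (hφ : L.IsCocycle φ) (X Y : Cₛ^∞⟮I; F, V⟯)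
    (f : C^∞⟮I, M; ℝ⟯) : L.twistedDer φ (L.bracket X Y) f
      = L.twistedDer φ X (L.twistedDer φ Y f) - L.twistedDer φ Y (L.twistedDer φ X f) := by
  have h : L.smoothDer X (smoothPairing φ Y) - L.smoothDer Y (smoothPairing φ X)
      - smoothPairing φ (L.bracket X Y) = 0 := DFunLike.coe_injective (hφ X Y)
  simp only [twistedDer, hL.smoothDer_bracket, smoothDer_add, smoothDer_mul]
  linear_combination -f * h

end Flat

end IsLieAlgebroid

variable [∀ x, IsTopologicalAddGroup (V x)] [∀ x, ContinuousSMul ℝ (V x)]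

variable (L) in
/-- The twisted Lie derivative is `ℒᵠ_X η (Y) = Dᵠ_X ⟨η, Y⟩ - ⟨η, [X, Y]⟩`, so that the bracket
`[α, β]_P` only involves the operators `Dᵠ` and the bracket of sections. -/
theorem dualBracket_eq (P : BundleMap I (F →L[ℝ] ℝ) (DualBundle V) F V) (α β : OneForm I F V)
    (Y : Cₛ^∞⟮I; F, V⟯) : L.dualBracket φ P α β Y =
      ⇑(L.twistedDer φ (P.onSections α) (smoothPairing β Y)
        - smoothPairing β (L.bracket (P.onSections α) Y)
        - (L.twistedDer φ (P.onSections β) (smoothPairing α Y)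
          - smoothPairing α (L.bracket (P.onSections β) Y))
        - L.twistedDer φ Y (smoothPairing β (P.onSections α))) := by
  funext x
  simp only [dualBracket, liePhi, dPhiForm, dForm, dPhiFun, tensor, twistedDer,
    ContMDiffMap.coe_add, ContMDiffMap.coe_sub, ContMDiffMap.coe_mul, Pi.add_apply, Pi.sub_apply,
    Pi.mul_apply, coe_smoothDer, coe_smoothPairing]
  ring

end AnchoredBracket

end Calculus

/-! ### The structure on the dual bundle -/

noncomputable section DualStructure

variable {E : Type*} [NormedAddCommGroup E] [NormedSpace ℝ E]
  {H : Type*} [TopologicalSpace H] {I : ModelWithCorners ℝ E H}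
  {M : Type*} [TopologicalSpace M] [ChartedSpace H M]
  {F : Type*} [NormedAddCommGroup F] [NormedSpace ℝ F]
  {V : M → Type*} [TopologicalSpace (TotalSpace F V)]
  [∀ x, AddCommGroup (V x)] [∀ x, Module ℝ (V x)] [∀ x, TopologicalSpace (V x)]
  [∀ x, IsTopologicalAddGroup (V x)] [∀ x, ContinuousSMul ℝ (V x)]
  [FiberBundle F V] [VectorBundle ℝ F V]
  {F' : Type*} [NormedAddCommGroup F'] [NormedSpace ℝ F']
  {W : M → Type*} [TopologicalSpace (TotalSpace F' W)]
  [∀ x, AddCommGroup (W x)] [∀ x, Module ℝ (W x)] [∀ x, TopologicalSpace (W x)]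
  [FiberBundle F' W] [VectorBundle ℝ F' W]

theorem BundleMap.onSections_add (Φ : BundleMap I F' W F V) (X Y : Cₛ^∞⟮I; F', W⟯) :
    Φ.onSections (X + Y) = Φ.onSections X + Φ.onSections Y :=
  ContMDiffSection.ext fun x ↦ map_add (Φ x) (X x) (Y x)

theorem BundleMap.onSections_sub (Φ : BundleMap I F' W F V) (X Y : Cₛ^∞⟮I; F', W⟯) :
    Φ.onSections (X - Y) = Φ.onSections X - Φ.onSections Y :=
  ContMDiffSection.ext fun x ↦ map_sub (Φ x) (X x) (Y x)

theorem BundleMap.onSections_funSMul (Φ : BundleMap I F' W F V) (f : C^∞⟮I, M; ℝ⟯)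
    (X : Cₛ^∞⟮I; F', W⟯) : Φ.onSections (X.funSMul f) = (Φ.onSections X).funSMul f :=
  ContMDiffSection.ext fun x ↦ map_smul (Φ x) (f x) (X x)

namespace AnchoredBracket

theorem IsBivector.smoothPairing_onSections {P : BundleMap I (F →L[ℝ] ℝ) (DualBundle V) F V}
    (hP : IsBivector P) (α β : OneForm I F V) :
    smoothPairing β (P.onSections α) = -smoothPairing α (P.onSections β) :=
  DFunLike.ext _ _ fun x ↦ hP x (α x) (β x)

variable [IsManifold I ∞ M]

variable {L : AnchoredBracket I F V} {φ : OneForm I F V}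
  {P : BundleMap I (F →L[ℝ] ℝ) (DualBundle V) F V}

/-- The equation `[P, P]ᵠ = 0`, halved and written with the operators `Dᵠ`. -/
theorem IsJacobiBivector.cyclic_sum_eq_zero (hP : L.IsJacobiBivector φ P) (α β γ : OneForm I F V) :
    smoothPairing α (L.bracket (P.onSections β) (P.onSections γ))
        - L.twistedDer φ (P.onSections α) (smoothPairing γ (P.onSections β))
      + (smoothPairing β (L.bracket (P.onSections γ) (P.onSections α))
        - L.twistedDer φ (P.onSections β) (smoothPairing α (P.onSections γ)))
      + (smoothPairing γ (L.bracket (P.onSections α) (P.onSections β))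
        - L.twistedDer φ (P.onSections γ) (smoothPairing β (P.onSections α))) = 0 := by
  ext x
  have h := congrFun (hP.schoutenJacobi_eq_zero α β γ) x
  have hs (θ : OneForm I F V) :
      pairing θ (P.onSections φ) x = -pairing φ (P.onSections θ) x := hP.isBivector x (φ x) (θ x)
  simp only [schoutenJacobi, schouten, wedge, tensor, Pi.add_apply, Pi.sub_apply,
    Pi.mul_apply, Pi.zero_apply, hs] at h
  simp only [twistedDer, ContMDiffMap.coe_add, ContMDiffMap.coe_sub, ContMDiffMap.coe_mul,
    ContMDiffMap.coe_zero, Pi.add_apply, Pi.sub_apply, Pi.mul_apply, Pi.zero_apply, coe_smoothDer,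
    coe_smoothPairing]
  linear_combination h / 2

theorem IsDualStructure.smoothPairing_bracket {D : AnchoredBracket I (F →L[ℝ] ℝ) (DualBundle V)}
    (hD : L.IsDualStructure φ P D) (α β : OneForm I F V) (Y : Cₛ^∞⟮I; F, V⟯) :
    smoothPairing (D.bracket α β) Y
      = L.twistedDer φ (P.onSections α) (smoothPairing β Y)
        - smoothPairing β (L.bracket (P.onSections α) Y)
        - (L.twistedDer φ (P.onSections β) (smoothPairing α Y)
          - smoothPairing α (L.bracket (P.onSections β) Y))
        - L.twistedDer φ Y (smoothPairing β (P.onSections α)) :=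
  DFunLike.coe_injective ((hD.bracket_eq α β Y).trans (L.dualBracket_eq φ P α β Y))

/-- The compatibility `[·, ·]_{NP} = [·, ·]_P^N`, with the terms common to both sides cancelled. -/
theorem IsJacobiNijenhuis.concomitant_eq_zero {N : BundleMap I F V F V}
    (h : L.IsJacobiNijenhuis φ P N) (α β : OneForm I F V) (Y : Cₛ^∞⟮I; F, V⟯) :
    smoothPairing β (L.bracket (P.onSections α) (N.onSections Y))
      - smoothPairing β (N.onSections (L.bracket (P.onSections α) Y))
      - smoothPairing α (L.bracket (P.onSections β) (N.onSections Y))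
      + smoothPairing α (N.onSections (L.bracket (P.onSections β) Y))
      - L.twistedDer φ Y (smoothPairing β (N.onSections (P.onSections α)))
      + L.twistedDer φ (N.onSections Y) (smoothPairing β (P.onSections α)) = 0 := by
  have h₁ := h.bracket_eq α β Y
  rw [dualBracket_eq, dualBracket_eq] at h₁
  have h₂ := DFunLike.coe_injective h₁
  have hc (α : OneForm I F V) : (N.comp P).onSections α = N.onSections (P.onSections α) := rfl
  have hd (X) (f : C^∞⟮I, M; ℝ⟯) : (L.deform N).twistedDer (N.transpose.onSections φ) X f
      = L.twistedDer φ (N.onSections X) f := rfl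
  have hb (X Y) : (L.deform N).bracket X Y = L.bracket (N.onSections X) Y
      + L.bracket X (N.onSections Y) - N.onSections (L.bracket X Y) := rfl
  simp only [hc, hd, hb, smoothPairing_add, smoothPairing_sub] at h₂
  linear_combination h₂

variable [FiniteDimensional ℝ E] [T2Space M] [ContMDiffVectorBundle ∞ F V I]

/-- The 1-form `[α, β]_P` exists: its defining expression is `C^∞(M)`-linear in `Y`. -/
theorem IsLieAlgebroid.exists_dualBracket [FiniteDimensional ℝ F] (hL : L.IsLieAlgebroid)
    (φ : OneForm I F V) (P : BundleMap I (F →L[ℝ] ℝ) (DualBundle V) F V) (α β : OneForm I F V) :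
    ∃ η : OneForm I F V, ∀ Y, pairing η Y = L.dualBracket φ P α β Y := by
  refine exists_oneForm_of_funSMul_linear (fun Y Z ↦ ?_) (fun f Y ↦ ?_) (fun Y ↦ ?_)
  · simp only [dualBracket_eq]
    rw [← ContMDiffMap.coe_add]
    congr 1
    simp only [hL.bracket_add, smoothPairing_add, twistedDer_add, add_twistedDer]
    ring
  · simp only [dualBracket_eq]
    rw [← ContMDiffMap.coe_mul]
    congr 1
    simp only [hL.bracket_funSMul, smoothPairing_add, smoothPairing_funSMul, twistedDer_mul,
      funSMul_twistedDer]
    ring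
  · rw [dualBracket_eq]
    exact ContMDiffMap.contMDiff _

theorem IsDualStructure.isLieAlgebroid {D : AnchoredBracket I (F →L[ℝ] ℝ) (DualBundle V)}
    (hD : L.IsDualStructure φ P D) (hL : L.IsLieAlgebroid) (hφ : L.IsCocycle φ)
    (hP : L.IsJacobiBivector φ P) : D.IsLieAlgebroid where
  bracket_add α β γ := oneForm_ext fun Y ↦ by
    simp only [hD.smoothPairing_bracket, add_smoothPairing, BundleMap.onSections_add,
      hL.add_bracket, smoothPairing_add, twistedDer_add, add_twistedDer]
    ring
  bracket_skew α β := oneForm_ext fun Y ↦ by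
    rw [neg_smoothPairing, hD.smoothPairing_bracket, hD.smoothPairing_bracket,
      hP.isBivector.smoothPairing_onSections α β, twistedDer_neg]
    ring
  jacobi α β γ := oneForm_ext fun Y ↦ by
    have hskew (X Y) (α : OneForm I F V) :
        smoothPairing α (L.bracket X Y) = -smoothPairing α (L.bracket Y X) := by
      rw [hL.bracket_skew, smoothPairing_neg]
    have hhom := twistedDual_map_eq (twistedDer_neg φ) smoothPairing_sub
      (fun _ ↦ section_eq_zero_of_smoothPairing) hskew hP.isBivector.smoothPairing_onSections
      hD.smoothPairing_bracket hP.cyclic_sum_eq_zero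
    exact twistedDual_jacobi (twistedDer_sub φ) smoothPairing_sub hskew hL.bracket_bracket
      (hL.twistedDer_bracket hφ) hP.isBivector.smoothPairing_onSections hD.smoothPairing_bracket
      hP.cyclic_sum_eq_zero hhom α β γ Y
  leibniz α β f hf x := by
    let g : C^∞⟮I, M; ℝ⟯ := ⟨f, hf⟩
    have h : D.bracket α (β.funSMul g)
        = (D.bracket α β).funSMul g + β.funSMul (L.smoothDer (P.onSections α) g) :=
      oneForm_ext fun Y ↦ by
        simp only [hD.smoothPairing_bracket, add_smoothPairing, funSMul_smoothPairing,
          BundleMap.onSections_funSMul, hL.funSMul_bracket, smoothPairing_sub,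
          smoothPairing_funSMul, twistedDer_mul, funSMul_twistedDer]
        rw [hP.isBivector.smoothPairing_onSections α β]
        ring
    have h' := DFunLike.congr_fun h x
    have hder : D.der α f = L.der (P.onSections α) f := by
      unfold der
      rw [hD.anchor_eq]
      rfl
    rw [hder]
    exact h'

theorem IsDualStructure.isNijenhuis_transpose
    {D : AnchoredBracket I (F →L[ℝ] ℝ) (DualBundle V)} {N : BundleMap I F V F V}
    (hD : L.IsDualStructure φ P D) (h : L.IsJacobiNijenhuis φ P N) :
    D.IsNijenhuis N.transpose := fun α β ↦ by
  have hPT (α : OneForm I F V) :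
      P.onSections (N.transpose.onSections α) = N.onSections (P.onSections α) :=
    (congrArg (fun Φ ↦ BundleMap.onSections Φ α) h.comp_eq).symm
  exact sub_eq_zero.2 <| oneForm_ext <| twistedDual_nijenhuis smoothPairing_sub smoothPairing_add
    sub_smoothPairing add_smoothPairing N.onSections_sub N.onSections_add
    (T := N.transpose.onSections) (fun _ _ ↦ rfl) hPT
    (fun X Y ↦ sub_eq_zero.1 (h.isNijenhuis X Y)) hD.smoothPairing_bracket
    h.concomitant_eq_zero α β

end AnchoredBracket

end DualStructure

theorem mainTheorem6 {E : Type*} [NormedAddCommGroup E] [NormedSpace ℝ E] [FiniteDimensional ℝ E]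
    {H : Type*} [TopologicalSpace H] (I : ModelWithCorners ℝ E H) [I.Boundaryless]
    {M : Type*} [TopologicalSpace M] [ChartedSpace H M] [IsManifold I ∞ M]
    [T2Space M] [SigmaCompactSpace M]
    {F : Type*} [NormedAddCommGroup F] [NormedSpace ℝ F] [FiniteDimensional ℝ F]
    {A : M → Type*} [TopologicalSpace (TotalSpace F A)]
    [∀ x, AddCommGroup (A x)] [∀ x, Module ℝ (A x)] [∀ x, TopologicalSpace (A x)]
    [∀ x, IsTopologicalAddGroup (A x)] [∀ x, ContinuousSMul ℝ (A x)]
    [FiberBundle F A] [VectorBundle ℝ F A] [ContMDiffVectorBundle ∞ F A I]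
    (L : AnchoredBracket I F A) (φ₀ : OneForm I F A)
    (P : BundleMap I (F →L[ℝ] ℝ) (DualBundle A) F A) (N : BundleMap I F A F A)
    (h : L.IsJacobiNijenhuis φ₀ P N) :
    ∃ D : AnchoredBracket I (F →L[ℝ] ℝ) (DualBundle A),
      L.IsDualStructure φ₀ P D ∧ D.IsLieAlgebroid ∧ D.IsNijenhuis N.transpose := by
  choose B hB using h.isLieAlgebroid.exists_dualBracket φ₀ P
  have hD : L.IsDualStructure φ₀ P ⟨L.anchor.comp P, B⟩ := ⟨hB, rfl⟩
  exact ⟨_, hD, hD.isLieAlgebroid h.isLieAlgebroid h.isCocycle h.isJacobiBivector,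
    hD.isNijenhuis_transpose h⟩
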